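/- There is a universal constant $0 < C_1 \le 23.15$ (independent of all the parameters below) for which the following holds. Let $n, N, m, k \ge 1$ be integers with $n \le N$ and $2k \le N$. Let $h \in \mathbb{R}^m$ satisfy $\|h\|_2 = 1/\sqrt{n}$, and let $A \in \mathbb{R}^{n\times N}$ be the random matrix with entries $$a_{pq} = \sum_{\ell=1}^{m} \epsilon^{pq}_\ell h_\ell, \qquad p = 1,\dots,n,\quad q = 1,\dots,N,$$ where the $\epsilon^{pq}_\ell$ are jointly independent random variables taking the values $+1$ and $-1$ with probability $1/2$ each. Let $\delta \in (0,1)$ and $t > 0$. If $$n \ge C_1\,\delta^{-2}\Bigl(k \log(N/k) + \log\bigl(2e + 24e/\delta\bigr) + t\Bigr),$$ then with probability at least $1 - e^{-t}$ the matrix $A$ has the restricted isometry property of order $k$ with constant $\delta$: for all $\Lambda \subset \{1,\dots,N\}$ of cardinality at most $k$ and all $x \in \mathbb{C}^N$ (in particular all $x\in\mathbb{R}^N$) supported on $\Lambda$, $$(1-\delta)\|x\|_2^2 \le \|Ax\|_2^2 \le (1+\delta)\|x\|_2^2 .$$ -/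

import Mathlib

open MeasureTheory ProbabilityTheory

noncomputable section

/-- The law of a Bernoulli `±1` (Rademacher) variable: mass `1/2` at `1` and at `-1`. -/
def rademacherLaw : Measure ℝ :=
  (2⁻¹ : ENNReal) • (Measure.dirac (1 : ℝ) + Measure.dirac (-1 : ℝ))

/-- The family `ε p q ℓ` consists of jointly independent Bernoulli `±1` variables. -/
structure IsRademacherFamily {Ω : Type*} [MeasurableSpace Ω] (μ : Measure Ω) {n N m : ℕ}
    (ε : Fin n → Fin N → Fin m → Ω → ℝ) : Prop where
  hasLaw : ∀ p q l, HasLaw (ε p q l) rademacherLaw μ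
  indep : iIndepFun (fun i : Fin n × Fin N × Fin m => ε i.1 i.2.1 i.2.2) μ

/-- The random `n × N` matrix with entries the Rademacher series
`a_{pq} = ∑_ℓ ε_ℓ^{pq} h_ℓ`. Its `q`-th column is `Ψ_q h`, where `Ψ_q` is the `n × m` matrix
with entries `ε_ℓ^{pq}`. -/
def rademacherSeriesMatrix {Ω : Type*} {n N m : ℕ} (ε : Fin n → Fin N → Fin m → Ω → ℝ)
    (h : EuclideanSpace ℝ (Fin m)) (ω : Ω) : Matrix (Fin n) (Fin N) ℝ :=
  Matrix.of fun p q => ∑ l, ε p q l ω * h l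

/-- The restricted isometry property of order `k` with constant `δ`, for a complex matrix:
for every index set `Λ` with at most `k` elements and every `x` supported on `Λ`,
`(1 - δ) ‖x‖₂² ≤ ‖A x‖₂² ≤ (1 + δ) ‖x‖₂²`. -/
def HasRIP {n N : ℕ} (A : Matrix (Fin n) (Fin N) ℂ) (k : ℕ) (δ : ℝ) : Prop :=
  ∀ L : Finset (Fin N), L.card ≤ k → ∀ x : EuclideanSpace ℂ (Fin N), (∀ q, q ∉ L → x q = 0) →
    (1 - δ) * ‖x‖ ^ 2 ≤ ‖WithLp.toLp 2 (A.mulVec x.ofLp)‖ ^ 2 ∧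
      ‖WithLp.toLp 2 (A.mulVec x.ofLp)‖ ^ 2 ≤ (1 + δ) * ‖x‖ ^ 2

end

/-! The proof combines concentration for one vector, a net on each coordinate subspace, and a union
bound over supports. For a fixed real unit vector `y`, `n * ‖A y‖²` is a sum of `n` independent
squares of normalized Rademacher sums. Each such sum `Y` has variance 1 and is subgaussian with
parameter 1, so `Y² - 1` has moment generating function at most `exp (2 s²)` for `|s| ≤ 1/4`.
Chernoff then gives a deviation `η ≤ 1` with probability at most `2 exp (-n η² / 8)`.

Near-isometry on a `1/20`-net of the sphere of a `k`-dimensional coordinate space, at most `41 ^ k`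
points, passes to the whole space with loss only `1 / (1 - 2/20) = 10/9`. The net is therefore
tested at `η = 9/10 * δ`. Keeping this loss linear in the mesh relies on the polarization argument
in `abs_norm_map_sq_sub_norm_sq_le_of_net`.

The union bound costs `choose N k * 41 ^ k`. The sample-size condition together with `n ≤ N` forces
`N / k ≥ 64`, so `41 ^ k` is absorbed into `(N / k) ^ k`, which makes the constant 23.15 sufficient.
Complex vectors reduce to real ones because a real matrix acts separately on real and imaginary
parts. -/

/-! ### Nets on the unit sphere -/

/-- Volume bound for `ε`-separated subsets of the unit ball. -/
theorem card_le_of_separated_unitBall {E : Type*} [NormedAddCommGroup E] [NormedSpace ℝ E]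
    [FiniteDimensional ℝ E] {ε : ℝ} (hε : 0 < ε) (s : Finset E) (hs : ∀ c ∈ s, ‖c‖ ≤ 1)
    (h : ∀ c ∈ s, ∀ d ∈ s, c ≠ d → ε ≤ ‖c - d‖) :
    (s.card : ℝ) ≤ (1 + 2 / ε) ^ Module.finrank ℝ E := by
  borelize E
  let μ : Measure E := Measure.addHaar
  set r : ℝ := ε / 2 with hr
  have hr0 : 0 < r := by positivity
  have hd : Set.Pairwise (s : Set E) (Function.onFun Disjoint fun c => Metric.ball (c : E) r) := by
    rintro c hc d hd hcd
    apply Metric.ball_disjoint_ball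
    rw [dist_eq_norm]
    linarith [h c hc d hd hcd]
  have hsub : (⋃ c ∈ s, Metric.ball (c : E) r) ⊆ Metric.ball (0 : E) (1 + r) := by
    refine Set.iUnion₂_subset fun x hx => Metric.ball_subset_ball' ?_
    rw [dist_zero_right]
    linarith [hs x hx]
  have hvol : (s.card : ENNReal) * ENNReal.ofReal (r ^ Module.finrank ℝ E) * μ (Metric.ball 0 1) ≤
      ENNReal.ofReal ((1 + r) ^ Module.finrank ℝ E) * μ (Metric.ball 0 1) := by
    have h1 := measure_mono (μ := μ) hsub
    rw [measure_biUnion_finset hd fun c _ => measurableSet_ball] at h1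
    simp only [μ.addHaar_ball_of_pos _ hr0, Finset.sum_const, nsmul_eq_mul] at h1
    rwa [μ.addHaar_ball_of_pos _ (by positivity : (0 : ℝ) < 1 + r), ← mul_assoc] at h1
  have hJ := (ENNReal.mul_le_mul_iff_left (Metric.measure_ball_pos _ _ zero_lt_one).ne'
    measure_ball_lt_top.ne).1 hvol
  have hK := ENNReal.toReal_le_of_le_ofReal (by positivity) hJ
  rw [ENNReal.toReal_mul, ENNReal.toReal_natCast, ENNReal.toReal_ofReal (by positivity),
    ← le_div_iff₀ (by positivity), ← div_pow] at hK
  convert! hK using 2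
  rw [hr]
  field_simp
  ring

/-- The unit sphere of a finite-dimensional space has an `ε`-net with at most `(1 + 2 / ε) ^ dim`
points. -/
theorem exists_finset_net_sphere (E : Type*) [NormedAddCommGroup E] [NormedSpace ℝ E]
    [FiniteDimensional ℝ E] {ε : ℝ} (hε : 0 < ε) :
    ∃ s : Finset E, (∀ y ∈ s, ‖y‖ = 1) ∧ (∀ x : E, ‖x‖ = 1 → ∃ y ∈ s, ‖x - y‖ ≤ ε) ∧
      (s.card : ℝ) ≤ (1 + 2 / ε) ^ Module.finrank ℝ E := by
  classical
  let P : Finset E → Prop := fun s =>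
    (∀ c ∈ s, ‖c‖ = 1) ∧ ∀ c ∈ s, ∀ d ∈ s, c ≠ d → ε ≤ ‖c - d‖
  have hP : ∀ s, P s → (s.card : ℝ) ≤ (1 + 2 / ε) ^ Module.finrank ℝ E := fun s hs =>
    card_le_of_separated_unitBall hε s (fun c hc => (hs.1 c hc).le) hs.2
  have hne : {n | ∃ s, P s ∧ s.card = n}.Nonempty := ⟨0, ∅, by simp [P], rfl⟩
  have hbdd : BddAbove {n | ∃ s, P s ∧ s.card = n} := by
    refine ⟨⌊(1 + 2 / ε) ^ Module.finrank ℝ E⌋₊, ?_⟩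
    rintro _ ⟨s, hs, rfl⟩
    exact Nat.le_floor (hP s hs)
  -- The volume bound lets a separated set of largest cardinality be chosen; a point farther than
  -- `ε` from it could be added, so it is a net.
  obtain ⟨s, hs, hcard⟩ := Nat.sSup_mem hne hbdd
  refine ⟨s, hs.1, fun x hx => ?_, hP s hs⟩
  by_contra! hfar
  have hxs : x ∉ s := fun hxs => by
    have := hfar x hxs
    simp at this
    linarith
  have hins : P (insert x s) := by
    refine ⟨fun c hc => ?_, fun c hc d hd hcd => ?_⟩
    · rcases Finset.mem_insert.1 hc with rfl | hc
      exacts [hx, hs.1 c hc]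
    · rcases Finset.mem_insert.1 hc with hcx | hc' <;> rcases Finset.mem_insert.1 hd with hdx | hd'
      · exact absurd (hcx.trans hdx.symm) hcd
      · exact hcx ▸ (hfar d hd').le
      · rw [norm_sub_rev]
        exact hdx ▸ (hfar c hc').le
      · exact hs.2 c hc' d hd' hcd
  have := le_csSup hbdd ⟨_, hins, rfl⟩
  rw [← hcard, Finset.card_insert_of_notMem hxs] at this
  lia

/-! ### From a net to the whole space -/

/-- If `‖T y‖²` is `η`-close to `1` on an `ε`-net of the unit sphere, then `T` is a near-isometry
with constant `η / (1 - 2 ε)`. -/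
theorem abs_norm_map_sq_sub_norm_sq_le_of_net {E F : Type*} [NormedAddCommGroup E]
    [InnerProductSpace ℝ E] [FiniteDimensional ℝ E] [NormedAddCommGroup F]
    [InnerProductSpace ℝ F] (T : E →ₗ[ℝ] F) {ε η : ℝ} (hε : 0 < ε) (hε2 : 2 * ε < 1)
    {s : Set E} (hs1 : ∀ y ∈ s, ‖y‖ = 1) (hnet : ∀ x : E, ‖x‖ = 1 → ∃ y ∈ s, ‖x - y‖ ≤ ε)
    (hη : ∀ y ∈ s, |‖T y‖ ^ 2 - 1| ≤ η) (x : E) :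
    |‖T x‖ ^ 2 - ‖x‖ ^ 2| ≤ η / (1 - 2 * ε) * ‖x‖ ^ 2 := by
  rcases eq_or_ne x 0 with rfl | hx0
  · simp
  have hT : Continuous T := T.continuous_of_finiteDimensional
  have hnorm : ∀ z : E, z ≠ 0 → ‖‖z‖⁻¹ • z‖ = 1 := fun z hz => norm_smul_inv_norm (𝕜 := ℝ) hz
  have hcont : Continuous fun z => |‖T z‖ ^ 2 - ‖z‖ ^ 2| := by fun_prop
  have : ProperSpace E := FiniteDimensional.proper ℝ E
  obtain ⟨z, hz, hmax⟩ := (isCompact_sphere (0 : E) 1).exists_isMaxOn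
    ⟨‖x‖⁻¹ • x, by simpa using hnorm x hx0⟩ hcont.continuousOn
  set M := |‖T z‖ ^ 2 - ‖z‖ ^ 2| with hM
  have hz1 : ‖z‖ = 1 := by simpa using hz
  have hMle : ∀ w : E, |‖T w‖ ^ 2 - ‖w‖ ^ 2| ≤ M * ‖w‖ ^ 2 := by
    intro w
    rcases eq_or_ne w 0 with rfl | hw
    · simp
    have h1 : |‖T (‖w‖⁻¹ • w)‖ ^ 2 - ‖‖w‖⁻¹ • w‖ ^ 2| ≤ M :=
      hmax (by simpa using hnorm w hw)
    have hw' : 0 < ‖w‖ := norm_pos_iff.2 hw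
    have h2 : ‖T (‖w‖⁻¹ • w)‖ ^ 2 - ‖‖w‖⁻¹ • w‖ ^ 2 = (‖T w‖ ^ 2 - ‖w‖ ^ 2) / ‖w‖ ^ 2 := by
      rw [map_smul, norm_smul, norm_smul, norm_inv, norm_norm]
      field_simp
    rwa [h2, abs_div, abs_of_pos (by positivity : 0 < ‖w‖ ^ 2), div_le_iff₀ (by positivity)] at h1
  obtain ⟨y, hy, hzy⟩ := hnet z hz1
  have hy1 := hs1 y hy
  -- With `f z = ‖T z‖² - ‖z‖²` and `B` its bilinear form, `f z - f y = B (z - y, z + y)`. Since `‖z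
  -- - y‖ ≤ ε` and `‖z + y‖ ≤ 2`, scaling the first argument by `2 / ε` balances the two before
  -- polarizing.
  set c : ℝ := 2 / ε with hc
  have hpol : ‖T (c • (z - y) + (z + y))‖ ^ 2 - ‖c • (z - y) + (z + y)‖ ^ 2
      - (‖T (c • (z - y) - (z + y))‖ ^ 2 - ‖c • (z - y) - (z + y)‖ ^ 2)
      = 4 * c * ((‖T z‖ ^ 2 - ‖z‖ ^ 2) - (‖T y‖ ^ 2 - ‖y‖ ^ 2)) := by
    simp only [← real_inner_self_eq_norm_sq, map_add, map_sub, map_smul, inner_add_left,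
      inner_add_right, inner_sub_left, inner_sub_right, real_inner_smul_left, real_inner_smul_right,
      real_inner_comm z y, real_inner_comm (T z) (T y)]
    ring
  have hpar : ‖c • (z - y) + (z + y)‖ ^ 2 + ‖c • (z - y) - (z + y)‖ ^ 2
      = 2 * (c ^ 2 * ‖z - y‖ ^ 2 + ‖z + y‖ ^ 2) := by
    have := parallelogram_law_with_norm ℝ (c • (z - y)) (z + y)
    rw [norm_smul, Real.norm_of_nonneg (by positivity)] at this
    linarith
  have hsum : ‖z + y‖ ^ 2 ≤ 4 := by
    have := norm_add_le z y
    nlinarith [norm_nonneg (z + y)]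
  have hdif : c ^ 2 * ‖z - y‖ ^ 2 ≤ 4 := by
    have : c * ‖z - y‖ ≤ 2 := by
      rw [hc, div_mul_eq_mul_div, div_le_iff₀ hε]
      linarith
    nlinarith [mul_nonneg (by positivity : 0 ≤ c) (norm_nonneg (z - y))]
  have hM0 : 0 ≤ M := abs_nonneg _
  have hdiff : |(‖T z‖ ^ 2 - ‖z‖ ^ 2) - (‖T y‖ ^ 2 - ‖y‖ ^ 2)| ≤ 2 * ε * M := by
    have h1 := abs_sub (‖T (c • (z - y) + (z + y))‖ ^ 2 - ‖c • (z - y) + (z + y)‖ ^ 2)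
      (‖T (c • (z - y) - (z + y))‖ ^ 2 - ‖c • (z - y) - (z + y)‖ ^ 2)
    rw [hpol, abs_mul, abs_of_pos (by positivity : 0 < 4 * c)] at h1
    have h2 := hMle (c • (z - y) + (z + y))
    have h3 := hMle (c • (z - y) - (z + y))
    have h4 : 4 * c * |(‖T z‖ ^ 2 - ‖z‖ ^ 2) - (‖T y‖ ^ 2 - ‖y‖ ^ 2)| ≤ M * 16 := by
      refine (h1.trans (add_le_add h2 h3)).trans ?_
      rw [← mul_add, hpar]
      exact mul_le_mul_of_nonneg_left (by linarith) hM0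
    rw [← le_div_iff₀' (by positivity)] at h4
    convert! h4 using 1
    rw [hc]
    field_simp
    ring
  have hMη : M ≤ η + 2 * ε * M := by
    have h1 := hη y hy
    have h2 := abs_sub_abs_le_abs_sub (‖T z‖ ^ 2 - ‖z‖ ^ 2) (‖T y‖ ^ 2 - ‖y‖ ^ 2)
    rw [hy1, one_pow] at h2 hdiff
    linarith
  refine (hMle x).trans (mul_le_mul_of_nonneg_right ?_ (by positivity))
  rw [le_div_iff₀ (by linarith)]
  linarith

/-! ### Moment generating functions of squares -/

/-- Rows of an independent array of random variables are independent random vectors. -/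
theorem iIndepFun_rows {Ω : Type*} [MeasurableSpace Ω] {μ : Measure Ω} {ι κ : Type*}
    [Finite ι] [Finite κ] {X : ι × κ → Ω → ℝ} (hX : ∀ i, AEMeasurable (X i) μ)
    (h : iIndepFun X μ) : iIndepFun (fun i ω (j : κ) => X (i, j) ω) μ := by
  have := h.isProbabilityMeasure
  have hp : ∀ i j, IsProbabilityMeasure (μ.map (X (i, j))) :=
    fun i j => Measure.isProbabilityMeasure_map (hX _)
  have hrow : ∀ i, AEMeasurable (fun ω (j : κ) => X (i, j) ω) μ :=
    fun i => aemeasurable_pi_iff.2 fun j => hX (i, j)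
  have hall : AEMeasurable (fun ω i => X i ω) μ := aemeasurable_pi_iff.2 hX
  rw [iIndepFun_iff_map_fun_eq_infinitePi_map₀' hrow]
  -- Currying turns the product law of the array into a product over rows of product laws.
  have h1 : (fun ω i (j : κ) => X (i, j) ω) =
      MeasurableEquiv.curry ι κ ℝ ∘ fun ω i => X i ω := rfl
  rw [h1, ← AEMeasurable.map_map_of_aemeasurable (by fun_prop) hall,
    h.map_fun_eq_infinitePi_map₀' hX, Measure.infinitePi_map_curry fun i j => μ.map (X (i, j))]
  congr 1
  funext i
  exact ((h.precomp (Prod.mk_right_injective i)).map_fun_eq_infinitePi_map₀'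
    fun j => hX (i, j)).symm

/-- Exponential square moment of a subgaussian variable, by decoupling with a Gaussian. -/
theorem lintegral_exp_sq_le_of_hasSubgaussianMGF {Ω : Type*} [MeasurableSpace Ω] {μ : Measure Ω}
    [IsProbabilityMeasure μ] {X : Ω → ℝ} (hX : HasSubgaussianMGF X 1 μ) {s : ℝ} (hs : 0 ≤ s)
    (hs2 : s < 1 / 2) :
    ∫⁻ ω, ENNReal.ofReal (Real.exp (s * X ω ^ 2)) ∂μ ≤ ENNReal.ofReal (√(1 - 2 * s))⁻¹ := by
  have hmeas : AEMeasurable X μ := hX.aemeasurable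
  -- Completing the square linearizes `exp (b y²)` as a Gaussian average of exponentials linear in
  -- `y`. It is used at `b = s`, `y = X ω`, and after Tonelli and the subgaussian bound at `b = s (1
  -- - 2 s)`, `y = 0`.
  have hgauss : ∀ b : ℝ, 0 < b → ∀ y : ℝ,
      ∫⁻ g : ℝ, ENNReal.ofReal (Real.exp (2 * b * y * g - b * g ^ 2)) =
        ENNReal.ofReal (√(Real.pi / b) * Real.exp (b * y ^ 2)) := by
    intro b hb y
    have h1 : ∀ g : ℝ, Real.exp (2 * b * y * g - b * g ^ 2) =
        Real.exp (b * y ^ 2) * Real.exp (-b * (g - y) ^ 2) := by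
      intro g
      rw [← Real.exp_add]
      ring_nf
    have hint : Integrable fun g : ℝ => Real.exp (-b * (g - y) ^ 2) :=
      (integrable_exp_neg_mul_sq hb).comp_sub_right y
    simp_rw [h1]
    rw [← ofReal_integral_eq_lintegral_ofReal (hint.const_mul _)
      (Filter.Eventually.of_forall fun g => by positivity), integral_const_mul,
      integral_sub_right_eq_self (fun g => Real.exp (-b * g ^ 2)) y, integral_gaussian, mul_comm]
  rcases hs.eq_or_lt with rfl | hs0
  · simp
  have hmgf : ∀ g : ℝ, ∫⁻ ω, ENNReal.ofReal (Real.exp (2 * s * X ω * g - s * g ^ 2)) ∂μ ≤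
      ENNReal.ofReal (Real.exp (2 * (s * (1 - 2 * s)) * 0 * g - s * (1 - 2 * s) * g ^ 2)) := by
    intro g
    have h1 : ∀ ω, Real.exp (2 * s * X ω * g - s * g ^ 2) =
        Real.exp (-(s * g ^ 2)) * Real.exp ((2 * s * g) * X ω) := by
      intro ω
      rw [← Real.exp_add]
      ring_nf
    simp_rw [h1]
    rw [← ofReal_integral_eq_lintegral_ofReal ((hX.integrable_exp_mul _).const_mul _)
      (Filter.Eventually.of_forall fun g => by positivity), integral_const_mul]
    refine ENNReal.ofReal_le_ofReal ?_
    have h2 := hX.mgf_le (2 * s * g)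
    rw [mgf] at h2
    refine (mul_le_mul_of_nonneg_left h2 (Real.exp_pos _).le).trans ?_
    rw [← Real.exp_add]
    refine le_of_eq (congrArg Real.exp ?_)
    push_cast
    ring
  have hswap : ∫⁻ ω, ENNReal.ofReal (√(Real.pi / s) * Real.exp (s * X ω ^ 2)) ∂μ ≤
      ENNReal.ofReal (√(Real.pi / (s * (1 - 2 * s))) * Real.exp (s * (1 - 2 * s) * 0 ^ 2)) := by
    rw [← hgauss (s * (1 - 2 * s)) (mul_pos hs0 (by linarith)) 0]
    simp_rw [← hgauss s hs0]
    rw [lintegral_lintegral_swap]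
    · exact lintegral_mono hmgf
    · have h1 : AEMeasurable (fun p : Ω × ℝ => X p.1) (μ.prod volume) := hmeas.comp_fst
      have h2 : Measurable fun p : Ω × ℝ => p.2 := measurable_snd
      exact (Real.measurable_exp.comp_aemeasurable
        (((h1.const_mul (2 * s)).mul h2.aemeasurable).sub
          ((h2.pow_const 2).const_mul s).aemeasurable)).ennreal_ofReal
  have hc : 0 < √(Real.pi / s) := Real.sqrt_pos.2 (by positivity)
  have hsplit : ∀ ω, ENNReal.ofReal (√(Real.pi / s) * Real.exp (s * X ω ^ 2)) =
      ENNReal.ofReal √(Real.pi / s) * ENNReal.ofReal (Real.exp (s * X ω ^ 2)) :=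
    fun ω => ENNReal.ofReal_mul hc.le
  have hrhs : √(Real.pi / (s * (1 - 2 * s))) * Real.exp (s * (1 - 2 * s) * 0 ^ 2) =
      √(Real.pi / s) * (√(1 - 2 * s))⁻¹ := by
    rw [← Real.sqrt_inv, ← Real.sqrt_mul (by positivity)]
    simp [div_eq_mul_inv, mul_comm, mul_assoc, mul_left_comm]
  simp_rw [hsplit, hrhs] at hswap
  rw [lintegral_const_mul' _ _ ENNReal.ofReal_ne_top, ENNReal.ofReal_mul hc.le] at hswap
  exact (ENNReal.mul_le_mul_iff_right (by simpa using hc) ENNReal.ofReal_ne_top).1 hswap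

theorem integrable_exp_sq_of_hasSubgaussianMGF {Ω : Type*} [MeasurableSpace Ω] {μ : Measure Ω}
    [IsProbabilityMeasure μ] {X : Ω → ℝ} (hX : HasSubgaussianMGF X 1 μ) {s : ℝ} (hs : 0 ≤ s)
    (hs2 : s < 1 / 2) : Integrable (fun ω => Real.exp (s * X ω ^ 2)) μ := by
  have hm : AEMeasurable X μ := hX.aemeasurable
  refine ⟨(by fun_prop : AEMeasurable _ μ).aestronglyMeasurable, ?_⟩
  rw [hasFiniteIntegral_iff_ofReal (Filter.Eventually.of_forall fun ω => (Real.exp_pos _).le)]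
  exact (lintegral_exp_sq_le_of_hasSubgaussianMGF hX hs hs2).trans_lt ENNReal.ofReal_lt_top

theorem integral_exp_sq_le_of_hasSubgaussianMGF {Ω : Type*} [MeasurableSpace Ω] {μ : Measure Ω}
    [IsProbabilityMeasure μ] {X : Ω → ℝ} (hX : HasSubgaussianMGF X 1 μ) {s : ℝ} (hs : 0 ≤ s)
    (hs2 : s < 1 / 2) : ∫ ω, Real.exp (s * X ω ^ 2) ∂μ ≤ (√(1 - 2 * s))⁻¹ := by
  have h := lintegral_exp_sq_le_of_hasSubgaussianMGF hX hs hs2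
  rwa [← ofReal_integral_eq_lintegral_ofReal (integrable_exp_sq_of_hasSubgaussianMGF hX hs hs2)
    (Filter.Eventually.of_forall fun ω => (Real.exp_pos _).le),
    ENNReal.ofReal_le_ofReal_iff (by positivity)] at h

/-- `(1 - 2 s)^(-1/2) ≤ exp (s + 2 s²)` for `0 ≤ s ≤ 1/4`. -/
theorem inv_sqrt_one_sub_le_exp {s : ℝ} (hs : 0 ≤ s) (hs2 : s ≤ 1 / 4) :
    (√(1 - 2 * s))⁻¹ ≤ Real.exp (s + 2 * s ^ 2) := by
  have h1 : 0 < 1 - 2 * s := by linarith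
  rw [inv_le_comm₀ (Real.sqrt_pos.2 h1) (Real.exp_pos _), ← Real.exp_neg]
  refine Real.le_sqrt_of_sq_le ?_
  rw [← Real.exp_nat_mul]
  have h2 : Real.exp (((2 : ℕ) : ℝ) * -(s + 2 * s ^ 2)) = (Real.exp (2 * s + 4 * s ^ 2))⁻¹ := by
    rw [← Real.exp_neg]
    push_cast
    ring_nf
  rw [h2, inv_le_comm₀ (Real.exp_pos _) h1]
  have h3 := Real.quadratic_le_exp_of_nonneg (by positivity : 0 ≤ 2 * s + 4 * s ^ 2)
  refine le_trans ?_ h3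
  rw [inv_le_iff_one_le_mul₀ h1]
  nlinarith [mul_nonneg hs hs, mul_nonneg (mul_nonneg hs hs) (by linarith : 0 ≤ 1 - 4 * s),
    mul_nonneg (mul_nonneg hs hs) (mul_nonneg hs (by linarith : 0 ≤ 1 - 4 * s))]

/-- `exp (-y) ≤ 1 - y + y² / 2` for `y ≥ 0`. -/
theorem exp_neg_le_quadratic {y : ℝ} (hy : 0 ≤ y) : Real.exp (-y) ≤ 1 - y + y ^ 2 / 2 := by
  rw [Real.exp_neg, inv_le_comm₀ (Real.exp_pos _) (by nlinarith [sq_nonneg (y - 1)])]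
  refine le_trans ?_ (Real.quadratic_le_exp_of_nonneg hy)
  rw [inv_le_iff_one_le_mul₀ (by nlinarith [sq_nonneg (y - 1)])]
  nlinarith [sq_nonneg (y ^ 2)]

theorem integral_even_quartic_of_hasSubgaussianMGF {Ω : Type*} [MeasurableSpace Ω]
    {μ : Measure Ω} [IsProbabilityMeasure μ] {X : Ω → ℝ} {c : NNReal}
    (hX : HasSubgaussianMGF X c μ) (a b : ℝ) :
    Integrable (fun ω => 1 + a * X ω ^ 2 + b * X ω ^ 4) μ ∧
      ∫ ω, (1 + a * X ω ^ 2 + b * X ω ^ 4) ∂μ =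
        1 + a * ∫ ω, X ω ^ 2 ∂μ + b * ∫ ω, X ω ^ 4 ∂μ := by
  have h2 : Integrable (fun ω => a * X ω ^ 2) μ := (hX.memLp 2).integrable_sq.const_mul a
  have h4 : Integrable (fun ω => b * X ω ^ 4) μ := by
    have h : Integrable (fun ω => |X ω| ^ 4) μ := by
      simpa using (hX.memLp 4).integrable_norm_pow (by norm_num)
    simp only [Even.pow_abs (by decide : Even 4)] at h
    exact h.const_mul b
  have h1 : Integrable (fun ω => 1 + a * X ω ^ 2) μ := (integrable_const 1).add h2
  refine ⟨h1.add h4, ?_⟩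
  rw [integral_add h1 h4, integral_add (integrable_const 1) h2, integral_const_mul,
    integral_const_mul]
  simp

/-- A standardized subgaussian variable has fourth moment at most `4`. -/
theorem integral_pow_four_le_of_hasSubgaussianMGF {Ω : Type*} [MeasurableSpace Ω]
    {μ : Measure Ω} [IsProbabilityMeasure μ] {X : Ω → ℝ} (hX : HasSubgaussianMGF X 1 μ)
    (hvar : ∫ ω, X ω ^ 2 ∂μ = 1) : ∫ ω, X ω ^ 4 ∂μ ≤ 4 := by
  have hexp := integral_exp_sq_le_of_hasSubgaussianMGF hX (s := 1 / 10) (by norm_num) (by norm_num)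
  have hi := integrable_exp_sq_of_hasSubgaussianMGF hX (s := 1 / 10) (by norm_num) (by norm_num)
  have hq := integral_even_quartic_of_hasSubgaussianMGF hX (1 / 10) (1 / 200)
  have hle : ∫ ω, (1 + 1 / 10 * X ω ^ 2 + 1 / 200 * X ω ^ 4) ∂μ ≤
      ∫ ω, Real.exp (1 / 10 * X ω ^ 2) ∂μ := by
    refine integral_mono hq.1 hi
      fun ω => ?_
    have := Real.quadratic_le_exp_of_nonneg (by positivity : 0 ≤ 1 / 10 * X ω ^ 2)
    refine le_trans (le_of_eq ?_) this
    ring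
  rw [hq.2, hvar] at hle
  -- The choice `s = 1/10` gives `1 + 1/10 + m₄ / 200 ≤ 1.12`, which is exactly `m₄ ≤ 4`.
  have hs : (√(1 - 2 * (1 / 10)))⁻¹ ≤ (1.12 : ℝ) := by
    rw [inv_le_comm₀ (Real.sqrt_pos.2 (by norm_num)) (by norm_num)]
    exact Real.le_sqrt_of_sq_le (by norm_num)
  norm_num at hexp hs
  linarith

/-- Two-sided exponential moment bound for the centred square of a standardized subgaussian
variable. -/
theorem mgf_sq_sub_one_le_of_hasSubgaussianMGF {Ω : Type*} [MeasurableSpace Ω]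
    {μ : Measure Ω} [IsProbabilityMeasure μ] {X : Ω → ℝ} (hX : HasSubgaussianMGF X 1 μ)
    (hvar : ∫ ω, X ω ^ 2 ∂μ = 1) {s : ℝ} (hs : |s| ≤ 1 / 4) :
    Integrable (fun ω => Real.exp (s * (X ω ^ 2 - 1))) μ ∧
      mgf (fun ω => X ω ^ 2 - 1) μ s ≤ Real.exp (2 * s ^ 2) := by
  have hsplit : ∀ ω, Real.exp (s * (X ω ^ 2 - 1)) = Real.exp (-s) * Real.exp (s * X ω ^ 2) := by
    intro ω
    rw [← Real.exp_add]
    ring_nf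
  have hm : AEMeasurable X μ := hX.aemeasurable
  suffices h : Integrable (fun ω => Real.exp (s * X ω ^ 2)) μ ∧
      ∫ ω, Real.exp (s * X ω ^ 2) ∂μ ≤ Real.exp (s + 2 * s ^ 2) by
    simp_rw [mgf, hsplit, integral_const_mul]
    refine ⟨h.1.const_mul _, (mul_le_mul_of_nonneg_left h.2 (Real.exp_pos _).le).trans ?_⟩
    rw [← Real.exp_add]
    ring_nf
    rfl
  rcases le_total 0 s with h0 | h0
  · rw [abs_of_nonneg h0] at hs
    exact ⟨integrable_exp_sq_of_hasSubgaussianMGF hX h0 (by linarith),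
      (integral_exp_sq_le_of_hasSubgaussianMGF hX h0 (by linarith)).trans
        (inv_sqrt_one_sub_le_exp h0 hs)⟩
  -- For negative `s` the second-order Taylor bound suffices: the fourth moment bound 4 yields `1 +
  -- s + 2 s² ≤ exp (s + 2 s²)`.
  · have hq := integral_even_quartic_of_hasSubgaussianMGF hX s (s ^ 2 / 2)
    have hi : Integrable (fun ω => Real.exp (s * X ω ^ 2)) μ := by
      refine Integrable.of_bound (C := 1) (by fun_prop : AEMeasurable _ μ).aestronglyMeasurable
        (Filter.Eventually.of_forall fun ω => ?_)
      rw [Real.norm_of_nonneg (Real.exp_pos _).le, Real.exp_le_one_iff]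
      exact mul_nonpos_of_nonpos_of_nonneg h0 (sq_nonneg _)
    refine ⟨hi, ?_⟩
    have hle : ∫ ω, Real.exp (s * X ω ^ 2) ∂μ ≤
        ∫ ω, (1 + s * X ω ^ 2 + s ^ 2 / 2 * X ω ^ 4) ∂μ := by
      refine integral_mono hi hq.1 fun ω => ?_
      have := exp_neg_le_quadratic (mul_nonneg (neg_nonneg.2 h0) (sq_nonneg (X ω)))
      rw [show -(-s * X ω ^ 2) = s * X ω ^ 2 by ring] at this
      refine this.trans (le_of_eq ?_)
      ring
    rw [hq.2, hvar] at hle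
    have h5 := mul_le_mul_of_nonneg_left (integral_pow_four_le_of_hasSubgaussianMGF hX hvar)
      (by positivity : 0 ≤ s ^ 2 / 2)
    have := Real.add_one_le_exp (s + 2 * s ^ 2)
    linarith

/-! ### Rademacher sums -/

theorem integral_rademacherLaw (f : ℝ → ℝ) : ∫ x, f x ∂rademacherLaw = (f 1 + f (-1)) / 2 := by
  rw [rademacherLaw, integral_smul_measure, integral_add_measure
    (integrable_dirac (by simp)) (integrable_dirac (by simp))]
  simp
  ring

theorem HasLaw.ae_eq_one_or_neg_one_of_rademacherLaw {Ω : Type*} [MeasurableSpace Ω] {μ : Measure Ω}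
    {X : Ω → ℝ} (hX : HasLaw X rademacherLaw μ) : ∀ᵐ ω ∂μ, X ω = 1 ∨ X ω = -1 := by
  have h : ∀ᵐ x ∂rademacherLaw, x = 1 ∨ x = -1 := by
    refine Measure.ae_smul_measure ?_ _
    rw [ae_add_measure_iff]
    simp [ae_dirac_eq]
  rw [← hX.map_eq] at h
  exact ae_of_ae_map hX.aemeasurable h

theorem HasLaw.integral_comp_rademacherLaw {Ω : Type*} [MeasurableSpace Ω] {μ : Measure Ω}
    {X : Ω → ℝ} (hX : HasLaw X rademacherLaw μ) {f : ℝ → ℝ} (hf : Measurable f) :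
    ∫ ω, f (X ω) ∂μ = (f 1 + f (-1)) / 2 := by
  rw [← integral_rademacherLaw, ← hX.map_eq,
    integral_map hX.aemeasurable hf.aestronglyMeasurable]

theorem HasLaw.hasSubgaussianMGF_of_rademacherLaw {Ω : Type*} [MeasurableSpace Ω]
    {μ : Measure Ω} [IsProbabilityMeasure μ] {X : Ω → ℝ} (hX : HasLaw X rademacherLaw μ) :
    HasSubgaussianMGF X 1 μ := by
  have h0 : ∫ ω, X ω ∂μ = 0 := by
    simpa using! HasLaw.integral_comp_rademacherLaw hX measurable_id
  have hmem : ∀ᵐ ω ∂μ, X ω ∈ Set.Icc (-1 : ℝ) 1 := by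
    filter_upwards [HasLaw.ae_eq_one_or_neg_one_of_rademacherLaw hX] with ω hω
    rcases hω with h | h <;> rw [h] <;> norm_num
  convert! hasSubgaussianMGF_of_mem_Icc_of_integral_eq_zero hX.aemeasurable hmem h0 using 1
  ext
  norm_num

/-- Subgaussian parameters add under independence, and scaling by `w i` multiplies the parameter by
`w i ^ 2`. -/
theorem hasSubgaussianMGF_rademacher_sum {Ω : Type*} [MeasurableSpace Ω] {μ : Measure Ω}
    [IsProbabilityMeasure μ] {ι : Type*} [Fintype ι] {X : ι → Ω → ℝ}
    (hX : ∀ i, HasLaw (X i) rademacherLaw μ) (hind : iIndepFun X μ) {w : ι → ℝ}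
    (hw : ∑ i, w i ^ 2 = 1) : HasSubgaussianMGF (fun ω => ∑ i, w i * X i ω) 1 μ := by
  have h1 := HasSubgaussianMGF.sum_of_iIndepFun (s := Finset.univ)
    (hind.comp (fun i x => w i * x) fun i => measurable_const_mul _)
    fun i _ => (HasLaw.hasSubgaussianMGF_of_rademacherLaw (hX i)).const_mul (w i)
  convert! h1 using 1
  ext
  push_cast
  rw [← hw]
  exact Finset.sum_congr rfl fun i _ => (mul_one (w i ^ 2)).symm

theorem integral_sq_rademacher_sum {Ω : Type*} [MeasurableSpace Ω] {μ : Measure Ω}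
    [IsProbabilityMeasure μ] {ι : Type*} [Fintype ι] {X : ι → Ω → ℝ}
    (hX : ∀ i, HasLaw (X i) rademacherLaw μ) (hind : iIndepFun X μ) (w : ι → ℝ) :
    ∫ ω, (∑ i, w i * X i ω) ^ 2 ∂μ = ∑ i, w i ^ 2 := by
  classical
  have hmem : ∀ i, MemLp (X i) 2 μ := fun i =>
    (HasLaw.hasSubgaussianMGF_of_rademacherLaw (hX i)).memLp 2
  have hint : ∀ i j, Integrable (fun ω => w i * w j * (X i ω * X j ω)) μ := fun i j =>
    ((hmem i).integrable_mul (hmem j)).const_mul _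
  have hcov : ∀ i j, ∫ ω, X i ω * X j ω ∂μ = if i = j then 1 else 0 := by
    intro i j
    split_ifs with hij
    · subst hij
      simpa using HasLaw.integral_comp_rademacherLaw (hX i) (f := fun x => x * x) (by fun_prop)
    · rw [(hind.indepFun hij).integral_fun_mul_eq_mul_integral
        (hmem i).aestronglyMeasurable (hmem j).aestronglyMeasurable,
        show ∫ ω, X i ω ∂μ = 0 by
          simpa using! HasLaw.integral_comp_rademacherLaw (hX i) measurable_id, zero_mul]
  have hexp : ∀ ω, (∑ i, w i * X i ω) ^ 2 = ∑ i, ∑ j, w i * w j * (X i ω * X j ω) := by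
    intro ω
    rw [sq, Finset.sum_mul_sum]
    exact Finset.sum_congr rfl fun i _ => Finset.sum_congr rfl fun j _ => by ring
  simp_rw [hexp]
  rw [integral_finsetSum _ fun i _ => integrable_finsetSum _ fun j _ => hint i j]
  simp_rw [integral_finsetSum _ fun j _ => hint _ j, integral_const_mul, hcov]
  simp [sq]

/-- Concentration of the average of squares of independent standardized subgaussian variables. -/
theorem measure_abs_sum_sq_sub_one_ge_le {Ω : Type*} [MeasurableSpace Ω] {μ : Measure Ω}
    [IsProbabilityMeasure μ] {n : ℕ} {Y : Fin n → Ω → ℝ}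
    (hY : ∀ p, HasSubgaussianMGF (Y p) 1 μ) (hvar : ∀ p, ∫ ω, Y p ω ^ 2 ∂μ = 1)
    (hind : iIndepFun Y μ) {η : ℝ} (hη : 0 ≤ η) (hη1 : η ≤ 1) :
    μ.real {ω | n * η ≤ |∑ p, (Y p ω ^ 2 - 1)|} ≤ 2 * Real.exp (-(n * (η ^ 2 / 8))) := by
  have hind' : iIndepFun (fun p ω => Y p ω ^ 2 - 1) μ :=
    hind.comp (fun _ x => x ^ 2 - 1) fun _ => by fun_prop
  have hmeas : ∀ p, AEMeasurable (fun ω => Y p ω ^ 2 - 1) μ := fun p =>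
    ((hY p).aemeasurable.pow_const 2).sub_const 1
  have hsum : (fun ω => ∑ p, (Y p ω ^ 2 - 1)) = ∑ p, fun ω => Y p ω ^ 2 - 1 := by
    ext ω
    simp
  have hmgf : ∀ s : ℝ, |s| ≤ 1 / 4 →
      Integrable (fun ω => Real.exp (s * ∑ p, (Y p ω ^ 2 - 1))) μ ∧
      mgf (fun ω => ∑ p, (Y p ω ^ 2 - 1)) μ s ≤ Real.exp (n * (2 * s ^ 2)) := by
    intro s hs
    have h1 := fun p => mgf_sq_sub_one_le_of_hasSubgaussianMGF (hY p) (hvar p) hs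
    constructor
    -- A non-integrable function has Bochner integral 0, whereas this one factors into positive
    -- moment generating functions.
    · refine not_imp_comm.1 integral_undef (ne_of_gt ?_)
      change 0 < mgf (fun ω => ∑ p, (Y p ω ^ 2 - 1)) μ s
      rw [hsum, hind'.mgf_sum₀ hmeas]
      exact Finset.prod_pos fun p _ => mgf_pos (h1 p).1
    · rw [hsum, hind'.mgf_sum₀ hmeas]
      refine (Finset.prod_le_prod (fun p _ => mgf_nonneg) fun p _ => (h1 p).2).trans ?_
      rw [Finset.prod_const, ← Real.exp_nat_mul]
      simp
  -- `s = η / 4` minimizes `-s η + 2 s²`, with value `-η² / 8`; `η ≤ 1` keeps it in the admissible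
  -- range.
  have hpos := hmgf (η / 4) (by rw [abs_of_nonneg (by positivity)]; linarith)
  have hneg := hmgf (-(η / 4)) (by rw [abs_neg, abs_of_nonneg (by positivity)]; linarith)
  have h1 := measure_ge_le_exp_mul_mgf (n * η) (by positivity : 0 ≤ η / 4) hpos.1
  have h2 := measure_le_le_exp_mul_mgf (-(n * η)) (by linarith : -(η / 4) ≤ 0) hneg.1
  have hsub : {ω | n * η ≤ |∑ p, (Y p ω ^ 2 - 1)|} ⊆
      {ω | n * η ≤ ∑ p, (Y p ω ^ 2 - 1)} ∪ {ω | ∑ p, (Y p ω ^ 2 - 1) ≤ -(n * η)} := by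
    intro ω hω
    rcases le_abs.1 (show n * η ≤ |∑ p, (Y p ω ^ 2 - 1)| from hω) with h | h
    · exact Or.inl h
    · exact Or.inr (show ∑ p, (Y p ω ^ 2 - 1) ≤ -(n * η) by linarith)
  refine (measureReal_mono hsub).trans ((measureReal_union_le _ _).trans ?_)
  have h3 := h1.trans (mul_le_mul_of_nonneg_left hpos.2 (Real.exp_pos _).le)
  have h4 := h2.trans (mul_le_mul_of_nonneg_left hneg.2 (Real.exp_pos _).le)
  rw [← Real.exp_add] at h3 h4
  rw [show -(η / 4) * (n * η) + n * (2 * (η / 4) ^ 2) = -(n * (η ^ 2 / 8)) by ring] at h3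
  rw [show - -(η / 4) * -(n * η) + n * (2 * (-(η / 4)) ^ 2) = -(n * (η ^ 2 / 8)) by ring] at h4
  linarith

/-! ### Reduction to real vectors and to nets -/

/-- The restricted isometry property of a real matrix can be checked on real vectors. -/
theorem hasRIP_map_of_real {n N : ℕ} {A : Matrix (Fin n) (Fin N) ℝ} {k : ℕ} {δ : ℝ}
    (hA : ∀ L : Finset (Fin N), L.card ≤ k → ∀ x : EuclideanSpace ℝ (Fin N),
      (∀ q, q ∉ L → x q = 0) → |‖Matrix.toEuclideanLin A x‖ ^ 2 - ‖x‖ ^ 2| ≤ δ * ‖x‖ ^ 2) :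
    HasRIP (A.map (algebraMap ℝ ℂ)) k δ := by
  intro L hL x hx
  let u : EuclideanSpace ℝ (Fin N) := WithLp.toLp 2 fun q => (x q).re
  let v : EuclideanSpace ℝ (Fin N) := WithLp.toLp 2 fun q => (x q).im
  have hu := hA L hL u fun q hq => by simp [u, hx q hq]
  have hv := hA L hL v fun q hq => by simp [v, hx q hq]
  have hxn : ‖x‖ ^ 2 = ‖u‖ ^ 2 + ‖v‖ ^ 2 := by
    simp only [EuclideanSpace.norm_sq_eq, ← Finset.sum_add_distrib]
    refine Finset.sum_congr rfl fun q _ => ?_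
    simp only [u, v, Real.norm_eq_abs, sq_abs, Complex.sq_norm, Complex.normSq_apply]
    ring
  have hAn : ‖WithLp.toLp 2 ((A.map (algebraMap ℝ ℂ)).mulVec x.ofLp)‖ ^ 2 =
      ‖Matrix.toEuclideanLin A u‖ ^ 2 + ‖Matrix.toEuclideanLin A v‖ ^ 2 := by
    simp only [EuclideanSpace.norm_sq_eq, ← Finset.sum_add_distrib]
    refine Finset.sum_congr rfl fun p _ => ?_
    have hre : ((A.map (algebraMap ℝ ℂ)).mulVec x.ofLp p).re = Matrix.toEuclideanLin A u p := by
      simp [Matrix.mulVec, dotProduct, u, Matrix.toLpLin_apply]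
    have him : ((A.map (algebraMap ℝ ℂ)).mulVec x.ofLp p).im = Matrix.toEuclideanLin A v p := by
      simp [Matrix.mulVec, dotProduct, v, Matrix.toLpLin_apply]
    rw [← hre, ← him]
    simp only [Real.norm_eq_abs, sq_abs, Complex.sq_norm, Complex.normSq_apply]
    ring
  rw [hAn, hxn]
  rw [abs_le] at hu hv
  constructor <;> linarith [hu.1, hu.2, hv.1, hv.2]

/-- A finite set of unit vectors on which it suffices to test near-isometry for vectors supported
on `L`. -/
theorem exists_finset_test_vectors {N k : ℕ} (L : Finset (Fin N)) (hL : L.card ≤ k) :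
    ∃ s : Finset (EuclideanSpace ℝ (Fin N)), (∀ y ∈ s, ‖y‖ = 1) ∧ s.card ≤ 41 ^ k ∧
      ∀ (n : ℕ) (A : Matrix (Fin n) (Fin N) ℝ) (δ : ℝ),
        (∀ y ∈ s, |‖Matrix.toEuclideanLin A y‖ ^ 2 - 1| ≤ 9 / 10 * δ) →
        ∀ x : EuclideanSpace ℝ (Fin N), (∀ q, q ∉ L → x q = 0) →
          |‖Matrix.toEuclideanLin A x‖ ^ 2 - ‖x‖ ^ 2| ≤ δ * ‖x‖ ^ 2 := by
  classical
  let b : Finset (EuclideanSpace ℝ (Fin N)) := L.image fun q => EuclideanSpace.single q (1 : ℝ)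
  let V : Submodule ℝ (EuclideanSpace ℝ (Fin N)) := Submodule.span ℝ b
  have hrank : Module.finrank ℝ V ≤ k :=
    (finrank_span_finset_le_card b).trans (Finset.card_image_le.trans hL)
  obtain ⟨s, hs1, hnet, hcard⟩ := exists_finset_net_sphere V (by norm_num : (0 : ℝ) < 1 / 20)
  refine ⟨s.image Subtype.val, ?_, ?_, fun n A δ hA x hx => ?_⟩
  · intro y hy
    obtain ⟨z, hz, rfl⟩ := Finset.mem_image.1 hy
    exact hs1 z hz
  · refine Finset.card_image_le.trans ?_
    have h1 : (s.card : ℝ) ≤ 41 ^ k := by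
      refine hcard.trans ?_
      norm_num
      exact pow_le_pow_right₀ (by norm_num) hrank
    exact_mod_cast h1
  · have hxV : x ∈ V := by
      have hsum : x = ∑ q ∈ L, x q • EuclideanSpace.single q (1 : ℝ) := by
        ext j
        simp only [WithLp.ofLp_sum, Finset.sum_apply, PiLp.smul_apply, PiLp.single_apply,
          smul_eq_mul, mul_ite, mul_one, mul_zero, Finset.sum_ite_eq]
        split_ifs with hj
        exacts [rfl, hx j hj]
      rw [hsum]
      exact Submodule.sum_mem _ fun q hq => Submodule.smul_mem _ _
        (Submodule.subset_span (Finset.mem_coe.2 (Finset.mem_image_of_mem _ hq)))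
    have h := abs_norm_map_sq_sub_norm_sq_le_of_net ((Matrix.toEuclideanLin A).comp V.subtype)
      (by norm_num : (0 : ℝ) < 1 / 20) (by norm_num) (s := s) hs1 hnet (η := 9 / 10 * δ)
      (fun y hy => hA y.1 (Finset.mem_image_of_mem _ hy)) ⟨x, hxV⟩
    convert! h using 2
    ring

/-! ### Concentration for the random matrix -/

/-- Each `√n * (A y) p` is a Rademacher sum with weights `√n * h l * y q`, whose squares sum to `n
‖h‖² ‖y‖² = 1`; distinct rows use disjoint signs, hence are independent. -/
theorem rademacherSeriesMatrix_concentration {Ω : Type*} [MeasurableSpace Ω] {μ : Measure Ω}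
    [IsProbabilityMeasure μ] {n N m : ℕ} {ε : Fin n → Fin N → Fin m → Ω → ℝ}
    {h : EuclideanSpace ℝ (Fin m)} (hε : IsRademacherFamily μ ε) (hn : 0 < n)
    (hh : ‖h‖ = 1 / √n) {y : EuclideanSpace ℝ (Fin N)} (hy : ‖y‖ = 1) {η : ℝ} (hη : 0 ≤ η)
    (hη1 : η ≤ 1) :
    μ.real {ω | η ≤ |‖Matrix.toEuclideanLin (rademacherSeriesMatrix ε h ω) y‖ ^ 2 - 1|} ≤
      2 * Real.exp (-(n * (η ^ 2 / 8))) := by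
  have hn0 : (0 : ℝ) < n := Nat.cast_pos.2 hn
  let w : Fin N × Fin m → ℝ := fun i => √n * (h i.2 * y i.1)
  have hhn : ∑ l, h l ^ 2 = 1 / n := by
    have := EuclideanSpace.norm_sq_eq h
    rw [hh, div_pow, Real.sq_sqrt hn0.le, one_pow] at this
    simpa using this.symm
  have hyn : ∑ q, y q ^ 2 = 1 := by
    have := EuclideanSpace.norm_sq_eq y
    rw [hy, one_pow] at this
    simpa using this.symm
  have hw : ∑ i, w i ^ 2 = 1 := by
    simp only [w, mul_pow, Real.sq_sqrt hn0.le]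
    rw [← Finset.mul_sum, Fintype.sum_prod_type]
    simp only [← Finset.sum_mul, hhn]
    rw [← Finset.mul_sum, hyn]
    field_simp
  let X : Fin n × Fin N × Fin m → Ω → ℝ := fun i => ε i.1 i.2.1 i.2.2
  have hX : ∀ i, HasLaw (X i) rademacherLaw μ := fun i => hε.hasLaw _ _ _
  have hXm : ∀ i, AEMeasurable (X i) μ := fun i => (hX i).aemeasurable
  let Y : Fin n → Ω → ℝ := fun p ω => ∑ i, w i * X (p, i) ω
  have hrow : ∀ p, iIndepFun (fun i => X (p, i)) μ := fun p =>
    hε.indep.precomp (Prod.mk_right_injective p)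
  have hYind : iIndepFun Y μ :=
    (iIndepFun_rows hXm hε.indep).comp (fun _ z => ∑ i, w i * z i) fun _ => by fun_prop
  have hconc := measure_abs_sum_sq_sub_one_ge_le (μ := μ) (Y := Y)
    (fun p => hasSubgaussianMGF_rademacher_sum (fun i => hX (p, i)) (hrow p) hw)
    (fun p => (integral_sq_rademacher_sum (fun i => hX (p, i)) (hrow p) w).trans hw)
    hYind hη hη1
  have hAY : ∀ ω, ∑ p, (Y p ω ^ 2 - 1) =
      n * (‖Matrix.toEuclideanLin (rademacherSeriesMatrix ε h ω) y‖ ^ 2 - 1) := by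
    intro ω
    have hent : ∀ p, Y p ω = √n * Matrix.toEuclideanLin (rademacherSeriesMatrix ε h ω) y p := by
      intro p
      simp only [Y, w, X, Matrix.toLpLin_apply, Matrix.mulVec, dotProduct,
        rademacherSeriesMatrix, Matrix.of_apply, Fintype.sum_prod_type, Finset.mul_sum,
        Finset.sum_mul]
      exact Finset.sum_congr rfl fun q _ => Finset.sum_congr rfl fun l _ => by ring
    rw [EuclideanSpace.norm_sq_eq, Finset.sum_sub_distrib, mul_sub, Finset.mul_sum]
    congr 1
    · refine Finset.sum_congr rfl fun p _ => ?_
      rw [hent, mul_pow, Real.sq_sqrt hn0.le, Real.norm_eq_abs, sq_abs]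
    · simp
  have hset : {ω | η ≤ |‖Matrix.toEuclideanLin (rademacherSeriesMatrix ε h ω) y‖ ^ 2 - 1|} =
      {ω | n * η ≤ |∑ p, (Y p ω ^ 2 - 1)|} := by
    ext ω
    simp only [Set.mem_ofPred_eq]
    rw [hAY, abs_mul, abs_of_pos hn0, mul_le_mul_iff_right₀ hn0]
  rw [hset]
  exact hconc

/-- Union bound over supports and nets. -/
theorem one_sub_le_measure_hasRIP {Ω : Type*} [MeasurableSpace Ω] {μ : Measure Ω}
    [IsProbabilityMeasure μ] {n N m k : ℕ} {ε : Fin n → Fin N → Fin m → Ω → ℝ}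
    {h : EuclideanSpace ℝ (Fin m)} (hε : IsRademacherFamily μ ε) (hn : 0 < n)
    (hh : ‖h‖ = 1 / √n) (hk : k ≤ N) {δ : ℝ} (hδ : 0 ≤ δ) (hδ1 : δ ≤ 1) :
    ENNReal.ofReal (1 - N.choose k * 41 ^ k *
        (2 * Real.exp (-(n * ((9 / 10 * δ) ^ 2 / 8))))) ≤
      μ {ω | HasRIP ((rademacherSeriesMatrix ε h ω).map (algebraMap ℝ ℂ)) k δ} := by
  classical
  let S := Finset.powersetCard k (Finset.univ : Finset (Fin N))
  have hex : ∀ L : Finset (Fin N), ∃ s : Finset (EuclideanSpace ℝ (Fin N)), (∀ y ∈ s, ‖y‖ = 1) ∧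
      (L.card = k → s.card ≤ 41 ^ k ∧ ∀ (n : ℕ) (A : Matrix (Fin n) (Fin N) ℝ) (δ : ℝ),
        (∀ y ∈ s, |‖Matrix.toEuclideanLin A y‖ ^ 2 - 1| ≤ 9 / 10 * δ) →
        ∀ x : EuclideanSpace ℝ (Fin N), (∀ q, q ∉ L → x q = 0) →
          |‖Matrix.toEuclideanLin A x‖ ^ 2 - ‖x‖ ^ 2| ≤ δ * ‖x‖ ^ 2) := by
    intro L
    obtain ⟨s, hs⟩ := exists_finset_test_vectors L le_rfl
    exact ⟨s, hs.1, fun hL => hL ▸ hs.2⟩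
  choose s hs1 hs2 using hex
  let bad : EuclideanSpace ℝ (Fin N) → Set Ω := fun y =>
    {ω | 9 / 10 * δ ≤ |‖Matrix.toEuclideanLin (rademacherSeriesMatrix ε h ω) y‖ ^ 2 - 1|}
  set R := {ω | HasRIP ((rademacherSeriesMatrix ε h ω).map (algebraMap ℝ ℂ)) k δ}
  have hcompl : Rᶜ ⊆ ⋃ L ∈ S, ⋃ y ∈ s L, bad y := by
    intro ω hω
    by_contra hgood
    simp only [Set.mem_iUnion, not_exists] at hgood
    refine hω (hasRIP_map_of_real fun L hL x hx => ?_)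
    -- Enlarging each support to exactly `k` indices leaves only `choose N k` supports in the union
    -- bound.
    obtain ⟨L', hLL', -, hL'⟩ := Finset.exists_subsuperset_card_eq (Finset.subset_univ L) hL
      (by simpa using hk)
    refine (hs2 L' hL').2 n _ δ (fun y hy => ?_) x fun q hq => hx q fun hqL => hq (hLL' hqL)
    have := hgood L' (Finset.mem_powersetCard_univ.2 hL') y hy
    exact (not_le.1 this).le
  have hbad : μ.real Rᶜ ≤ N.choose k * 41 ^ k *
      (2 * Real.exp (-(n * ((9 / 10 * δ) ^ 2 / 8)))) := by
    refine (measureReal_mono hcompl (measure_ne_top _ _)).trans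
      ((measureReal_biUnion_finset_le _ _).trans ?_)
    have h1 : ∀ L ∈ S, μ.real (⋃ y ∈ s L, bad y) ≤
        41 ^ k * (2 * Real.exp (-(n * ((9 / 10 * δ) ^ 2 / 8)))) := by
      intro L hL
      refine (measureReal_biUnion_finset_le _ _).trans ?_
      refine (Finset.sum_le_card_nsmul _ _ _ fun y hy => rademacherSeriesMatrix_concentration hε hn
        hh (hs1 L y hy) (by positivity) (by linarith)).trans ?_
      rw [nsmul_eq_mul]
      refine mul_le_mul_of_nonneg_right ?_ (by positivity)
      exact_mod_cast (hs2 L (Finset.mem_powersetCard_univ.1 hL)).1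
    refine (Finset.sum_le_card_nsmul _ _ _ h1).trans (le_of_eq ?_)
    rw [nsmul_eq_mul, Finset.card_powersetCard, Finset.card_univ, Fintype.card_fin, mul_assoc]
  have hone : (1 : ENNReal) ≤ μ R + μ Rᶜ := by
    rw [← measure_univ (μ := μ), ← Set.union_compl_self R]
    exact measure_union_le _ _
  rw [ENNReal.ofReal_sub _ (by positivity), ENNReal.ofReal_one, tsub_le_iff_right]
  refine hone.trans (add_le_add le_rfl ?_)
  rw [← ofReal_measureReal]
  exact ENNReal.ofReal_le_ofReal hbad

/-! ### Parameter bounds -/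

/-- Write `N^k / k! = (k^k / k!) (N / k)^k`; the first factor is a single term of the series of `exp
k`. -/
theorem choose_le_exp {N k : ℕ} (hk : 0 < k) (hN : 0 < N) :
    (N.choose k : ℝ) ≤ Real.exp (k + k * Real.log (N / k)) := by
  have hk0 : (0 : ℝ) < k := Nat.cast_pos.2 hk
  have hN0 : (0 : ℝ) < N := Nat.cast_pos.2 hN
  have h1 := Real.pow_div_factorial_le_exp (x := (k : ℝ)) hk0.le k
  have h2 : (N.choose k : ℝ) ≤ (N : ℝ) ^ k / k.factorial := Nat.choose_le_pow_div k N
  rw [Real.exp_add, Real.exp_nat_mul (Real.log _), Real.exp_log (by positivity)]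
  refine h2.trans ?_
  calc (N : ℝ) ^ k / k.factorial = (k : ℝ) ^ k / k.factorial * ((N : ℝ) / k) ^ k := by
        rw [div_pow]
        field_simp
    _ ≤ _ := mul_le_mul_of_nonneg_right h1 (by positivity)

/-- If `r ≥ 2` and `r ≥ 23.15 log r` then `r ≥ 64`. -/
theorem sixty_four_le_of_log_le {r : ℝ} (hr : 2 ≤ r) (h : 23.15 * Real.log r ≤ r) : 64 ≤ r := by
  have hlog2 := Real.log_two_gt_d9
  have h1 : Real.log 2 ≤ Real.log r := Real.log_le_log (by norm_num) hr
  -- Bootstrap: `23.15 * log 2 > 16`, and then `23.15 * log 16 > 64`.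
  have h16 : (2 : ℝ) ^ 4 ≤ r := by linarith
  have h2 := Real.log_le_log (by norm_num) h16
  rw [Real.log_pow] at h2
  push_cast at h2
  linarith

/-- The failure probability of the union bound is at most `exp (-t)`. -/
theorem union_bound_le_exp_neg {n N k : ℕ} {δ t : ℝ} (hδ : 0 < δ) (hδ1 : δ < 1) (ht : 0 < t)
    (hk : 1 ≤ k) (hkN : 2 * k ≤ N) (hnN : n ≤ N)
    (hn : 23.15 * (δ ^ 2)⁻¹ * ((k : ℝ) * Real.log ((N : ℝ) / k)
      + Real.log (2 * Real.exp 1 + 24 * Real.exp 1 / δ) + t) ≤ (n : ℝ)) :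
    N.choose k * 41 ^ k * (2 * Real.exp (-(n * ((9 / 10 * δ) ^ 2 / 8)))) ≤ Real.exp (-t) := by
  have hk1 : (1 : ℝ) ≤ k := by exact_mod_cast hk
  have hk0 : (0 : ℝ) < k := by linarith
  have hkN' : (2 : ℝ) * k ≤ N := by exact_mod_cast hkN
  have hnN' : (n : ℝ) ≤ N := by exact_mod_cast hnN
  set r : ℝ := N / k with hr
  have hr2 : 2 ≤ r := by rwa [hr, le_div_iff₀ hk0]
  have hlogr : 0 < Real.log r := Real.log_pos (by linarith)
  set ℓ := Real.log (2 * Real.exp 1 + 24 * Real.exp 1 / δ) with hℓ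
  have hlog2 := Real.log_two_gt_d9
  -- The term `ℓ` serves only to absorb the factor 2 of the two-sided tail.
  have hℓ2 : Real.log 2 ≤ ℓ := by
    refine Real.log_le_log (by norm_num) ?_
    have := Real.add_one_le_exp 1
    have h2 : 0 < 24 * Real.exp 1 / δ := by positivity
    linarith
  have hS : 23.15 * (k * Real.log r + ℓ + t) ≤ n * δ ^ 2 := by
    have hδ2 : 0 < δ ^ 2 := by positivity
    have := mul_le_mul_of_nonneg_right hn hδ2.le
    refine le_trans (le_of_eq ?_) this
    field_simp
  -- Here `n ≤ N` enters: `23.15 * k * log r ≤ n δ² ≤ N = k * r`.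
  have hr64 : 64 ≤ r := by
    refine sixty_four_le_of_log_le hr2 ?_
    rw [hr, le_div_iff₀ hk0, ← hr]
    have : n * δ ^ 2 ≤ n := mul_le_of_le_one_right (Nat.cast_nonneg n) (by nlinarith)
    nlinarith
  have hlog64 : 6 * Real.log 2 ≤ Real.log r := by
    have := Real.log_le_log (by norm_num : (0 : ℝ) < 2 ^ 6) (by linarith : (2 : ℝ) ^ 6 ≤ r)
    rwa [Real.log_pow] at this
  have h41 : (41 : ℝ) ^ k ≤ Real.exp (k * Real.log r) := by
    rw [Real.exp_nat_mul, Real.exp_log (by linarith)]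
    exact pow_le_pow_left₀ (by norm_num) (by linarith) k
  have hchoose : (N.choose k : ℝ) ≤ Real.exp (k + k * Real.log r) :=
    choose_le_exp (by lia) (by lia)
  calc N.choose k * 41 ^ k * (2 * Real.exp (-(n * ((9 / 10 * δ) ^ 2 / 8))))
      ≤ Real.exp (k + k * Real.log r) * Real.exp (k * Real.log r) *
        (Real.exp (Real.log 2) * Real.exp (-(n * ((9 / 10 * δ) ^ 2 / 8)))) := by
        rw [Real.exp_log two_pos]
        gcongr
    _ = Real.exp (k + k * Real.log r + k * Real.log r +
          (Real.log 2 + -(n * ((9 / 10 * δ) ^ 2 / 8)))) := by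
        simp only [Real.exp_add]
    _ ≤ Real.exp (-t) := by
        -- Since `23.15 * 0.81 / 8 > 2.34`, two copies of `k log r` pay for the choice of support
        -- and the net, and the surplus `0.34 * k log r` covers the remaining `k` because `log r ≥ 6
        -- log 2 > 4`.
        refine Real.exp_le_exp.2 ?_
        have h1 : (k : ℝ) * (6 * Real.log 2) ≤ k * Real.log r :=
          mul_le_mul_of_nonneg_left hlog64 hk0.le
        nlinarith

theorem mainTheorem5 :
    ∃ C₁ : ℝ, 0 < C₁ ∧ C₁ ≤ 23.15 ∧
      ∀ (Ω : Type*) [MeasurableSpace Ω] (μ : Measure Ω) [IsProbabilityMeasure μ]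
        (n N m k : ℕ) (ε : Fin n → Fin N → Fin m → Ω → ℝ) (h : EuclideanSpace ℝ (Fin m))
        (δ t : ℝ),
        IsRademacherFamily μ ε →
        ‖h‖ = 1 / Real.sqrt n →
        0 < δ → δ < 1 → 0 < t →
        1 ≤ k → 2 * k ≤ N → n ≤ N →
        C₁ * (δ ^ 2)⁻¹ * ((k : ℝ) * Real.log ((N : ℝ) / k)
            + Real.log (2 * Real.exp 1 + 24 * Real.exp 1 / δ) + t) ≤ (n : ℝ) →
        ENNReal.ofReal (1 - Real.exp (-t)) ≤
          μ {ω | HasRIP ((rademacherSeriesMatrix ε h ω).map (algebraMap ℝ ℂ)) k δ} := by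
  refine ⟨23.15, by norm_num, le_rfl, ?_⟩
  intro Ω _ μ _ n N m k ε h δ t hε hh hδ hδ1 ht hk hkN hnN hn
  have hbound := union_bound_le_exp_neg hδ hδ1 ht hk hkN hnN hn
  have hn0 : 0 < n := by
    rw [← Nat.cast_pos (α := ℝ)]
    refine lt_of_lt_of_le ?_ hn
    have hk0 : (1 : ℝ) ≤ k := by exact_mod_cast hk
    have hkN' : (2 : ℝ) * k ≤ N := by exact_mod_cast hkN
    have h1 : 0 ≤ Real.log ((N : ℝ) / k) := Real.log_nonneg (by
      rw [le_div_iff₀ (by linarith)]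
      linarith)
    have h2 : 0 ≤ Real.log (2 * Real.exp 1 + 24 * Real.exp 1 / δ) := Real.log_nonneg (by
      have := Real.add_one_le_exp 1
      have : 0 < 24 * Real.exp 1 / δ := by positivity
      linarith)
    positivity
  refine le_trans (ENNReal.ofReal_le_ofReal ?_)
    (one_sub_le_measure_hasRIP hε hn0 hh (by lia) hδ.le hδ1.le)
  linarith
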